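/- **Theorem 7.2.** Throughout, a *Lip-norm* on a unital $C^*$-algebra $A$ is a function $L\colon A_{sa}\to[0,\infty]$ on the self-adjoint part such that: $L(a+b)\le L(a)+L(b)$ and $L(ra)=|r|L(a)$ for $r\in\mathbb R$ (with $0\cdot\infty=0$); the real subspace $\operatorname{dom}L=\{a : L(a)<\infty\}$ is norm dense in $A_{sa}$; $L(1)=0$; and the topology on the state space $S(A)$ given by $\rho_L(\mu,\nu)=\sup\{|\mu(a)-\nu(a)| : L(a)\le 1\}$ is the weak-$*$ topology. (Equivalently, $L$ is a finite-valued Lip-norm on the dense order-unit subspace $\operatorname{dom}L$.) The *closure* of $L$ is $L^c(a)=\inf\{r\ge 0 : a\in\overline{\{x\in A_{sa} : L(x)\le r\}}\}$ (norm closure, $\inf\emptyset=\infty$); $L^c=L$ exactly when $L$ is lower semicontinuous for the norm. For $n\ge 1$ let $UCP_n(A)$ be the set of unital completely positive maps $A\to M_n(\mathbb C)$, and let $\rho_{L,n}(\varphi,\psi)=\sup\{\|\varphi(a)-\psi(a)\| : a\in A_{sa},\ L(a)\le 1\}$. Given Lip-norms $L_A$ on $A$ and $L_B$ on $B$, let $\mathcal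 M(L_A,L_B)$ be the set of Lip-norms $L$ on $A\oplus B$ with $\operatorname{dom}L=\operatorname{dom}L_A\oplus\operatorname{dom}L_B$ whose quotient seminorms are $L_A$ and $L_B$, that is, $L_A(a)=\inf_{b\in B_{sa}}L(a,b)$ for all $a\in A_{sa}$ and $L_B(b)=\inf_{a\in A_{sa}}L(a,b)$ for all $b\in B_{sa}$. Viewing $UCP_n(A)$ and $UCP_n(B)$ as subsets of $UCP_n(A\oplus B)$ through composition with the coordinate projections, Kerr's matricial $n$-distance is $$\operatorname{dist}_s^n(A,B)=\inf\{\operatorname{dist}_H^{\rho_{L,n}}(UCP_n(A),UCP_n(B)) : L\in\mathcal M(L_A,L_B)\},$$ where $\operatorname{dist}_H^{\rho}$ is the Hausdorff distance for $\rho$. Let $A$ and $B$ be unital $C^*$-algebras equipped with Lip-norms $L_A$ and $L_B$. If $\operatorname{dist}_s^2(A,B)=0$, then there is an isometric $*$-algebra isomorphism $\Phi$ of $A$ onto $B$ which carries $L_A$ to $L_B$, in the sense that $L_B^c(\Phi(a))=L_A^c(a)$ for all $a\in A_{sa}$. In particular, if $L_A$ and $L_B$ are lower semicontinuous, then $L_B(\Phi(a))=L_A(a)$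 for all $a\in A_{sa}$. -/

import Mathlib

open scoped ENNReal Topology ComplexOrder CStarAlgebra

noncomputable section

namespace QuantumMetric

/-- The state space of a unital C⋆-algebra, as a subset of the dual with its weak-⋆ topology. -/
def stateSpace (A : Type*) [CStarAlgebra A] [PartialOrder A] : Set (WeakDual ℂ A) :=
  {μ | (∀ a : A, 0 ≤ a → 0 ≤ μ a) ∧ μ 1 = 1}

/-- The extended pseudometric `ρ_L(μ, ν) = sup {|μ(a) - ν(a)| : L(a) ≤ 1}` on the state space.
The functional `L` is given on the self-adjoint part and may take the value `∞`. -/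
@[reducible]
def stateMetric {A : Type*} [CStarAlgebra A] [PartialOrder A] (L : selfAdjoint A → ℝ≥0∞) :
    PseudoEMetricSpace (stateSpace A) where
  edist μ ν := ⨆ (a : selfAdjoint A) (_ : L a ≤ 1), edist (μ.1 (a : A)) (ν.1 (a : A))
  edist_self μ := by simp
  edist_comm μ ν := by simp only [edist_comm]
  edist_triangle μ ν ξ := by
    refine iSup₂_le fun a ha => (edist_triangle _ (ν.1 (a : A)) _).trans (add_le_add ?_ ?_)
    · exact le_iSup₂ (f := fun (a : selfAdjoint A) (_ : L a ≤ 1) =>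
        edist (μ.1 (a : A)) (ν.1 (a : A))) a ha
    · exact le_iSup₂ (f := fun (a : selfAdjoint A) (_ : L a ≤ 1) =>
        edist (ν.1 (a : A)) (ξ.1 (a : A))) a ha

/-- Lip-norms on (the self-adjoint part of) a unital C⋆-algebra.  A seminorm with finite values
on a dense real subspace of the self-adjoint part that contains the unit is encoded by its
extension by `∞`, so the subspace is `{a | L a < ∞}`.  No lower semicontinuity is required. -/
structure IsLipNorm {A : Type*} [CStarAlgebra A] [PartialOrder A]
    (L : selfAdjoint A → ℝ≥0∞) : Prop where
  add_le (a b : selfAdjoint A) : L (a + b) ≤ L a + L b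
  smul (r : ℝ) (a : selfAdjoint A) : L (r • a) = ‖r‖ₑ * L a
  dense : Dense {a | L a < ∞}
  map_one : L 1 = 0
  /-- The topology of `ρ_L` on the state space is the weak-⋆ topology. -/
  topology_eq :
    (stateMetric L).toUniformSpace.toTopologicalSpace =
      (instTopologicalSpaceSubtype : TopologicalSpace (stateSpace A))

/-- The closure of `L`: the extended seminorm with `closure L a = inf {r : a ∈ cl {L ≤ r}}`
(equivalently, the Minkowski functional of the norm closure of `{L ≤ 1}`).
It is the largest lower semicontinuous function below `L`. -/
def lipClosure {A : Type*} [CStarAlgebra A] (L : selfAdjoint A → ℝ≥0∞) (a : selfAdjoint A) :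
    ℝ≥0∞ :=
  sInf {r : ℝ≥0∞ | a ∈ closure {x | L x ≤ r}}

/-- The self-adjoint element `(a, b)` of the direct sum `A ⊕ B`. -/
def pair {A B : Type*} [CStarAlgebra A] [CStarAlgebra B] (a : selfAdjoint A)
    (b : selfAdjoint B) : selfAdjoint (A × B) :=
  ⟨((a : A), (b : B)), selfAdjoint.mem_iff.mpr (Prod.ext a.2 b.2)⟩

/-- `M(L_A, L_B)`: the Lip-norms on the direct sum (finite exactly on the direct sum of the
domains of `L_A` and `L_B`) whose quotient seminorms on `A` and `B` are `L_A` and `L_B`. -/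
structure IsAdmissible {A B : Type*} [CStarAlgebra A] [PartialOrder A] [CStarAlgebra B]
    [PartialOrder B] (LA : selfAdjoint A → ℝ≥0∞) (LB : selfAdjoint B → ℝ≥0∞)
    (L : selfAdjoint (A × B) → ℝ≥0∞) : Prop where
  isLipNorm : IsLipNorm L
  lt_top_iff (a : selfAdjoint A) (b : selfAdjoint B) :
    L (pair a b) < ∞ ↔ LA a < ∞ ∧ LB b < ∞
  quotient_left (a : selfAdjoint A) : LA a = ⨅ b : selfAdjoint B, L (pair a b)
  quotient_right (b : selfAdjoint B) : LB b = ⨅ a : selfAdjoint A, L (pair a b)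

/-- The `n`-th matricial state space: unital completely positive maps `A → M_n(ℂ)`. -/
def UCP (n : ℕ) (A : Type*) [CStarAlgebra A] [PartialOrder A] [StarOrderedRing A] : Type _ :=
  {φ : A →CP CStarMatrix (Fin n) (Fin n) ℂ // φ 1 = 1}

/-- Composition of a matricial state with a unital ⋆-homomorphism. -/
def UCP.comp {n : ℕ} {A C : Type*} [CStarAlgebra A] [PartialOrder A] [StarOrderedRing A]
    [CStarAlgebra C] [PartialOrder C] [StarOrderedRing C] (φ : UCP n A) (π : C →⋆ₐ[ℂ] A) :
    UCP n C :=
  ⟨{ φ.1.toLinearMap ∘ₗ (π.toAlgHom.toLinearMap : C →ₗ[ℂ] A) with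
      map_cstarMatrix_nonneg' := fun k M hM =>
        φ.1.map_cstarMatrix_nonneg' k (M.map π)
          (CompletelyPositiveMapClass.map_cstarMatrix_nonneg' π k M hM) },
    (congrArg φ.1 (map_one π)).trans φ.2⟩

/-- `ρ_{L,n}(φ, ψ) = sup {‖φ(a) - ψ(a)‖ : L(a) ≤ 1}` on the `n`-th matricial state space. -/
def ucpDist {n : ℕ} {A : Type*} [CStarAlgebra A] [PartialOrder A] [StarOrderedRing A]
    (L : selfAdjoint A → ℝ≥0∞) (φ ψ : UCP n A) : ℝ≥0∞ :=
  ⨆ (a : selfAdjoint A) (_ : L a ≤ 1), ‖φ.1 (a : A) - ψ.1 (a : A)‖ₑ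

/-- Hausdorff distance of two subsets for a distance function `ρ`: the infimum of the `r` such
that each set lies in the open `r`-neighbourhood of the other (`∞` if there is no such `r`). -/
def hausdorffDistOf {Z : Type*} (ρ : Z → Z → ℝ≥0∞) (X Y : Set Z) : ℝ≥0∞ :=
  sInf {r : ℝ≥0∞ | (∀ y ∈ Y, ∃ x ∈ X, ρ y x < r) ∧ (∀ x ∈ X, ∃ y ∈ Y, ρ x y < r)}

/-- Kerr's matricial `n`-distance.  `UCP_n(A)` and `UCP_n(B)` are embedded in `UCP_n(A ⊕ B)` by
composition with the coordinate projections. -/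
def matricialDist (n : ℕ) {A B : Type*} [CStarAlgebra A] [PartialOrder A] [StarOrderedRing A]
    [CStarAlgebra B] [PartialOrder B] [StarOrderedRing B]
    (LA : selfAdjoint A → ℝ≥0∞) (LB : selfAdjoint B → ℝ≥0∞) : ℝ≥0∞ :=
  ⨅ (L : selfAdjoint (A × B) → ℝ≥0∞) (_ : IsAdmissible LA LB L),
    hausdorffDistOf (ucpDist L)
      (Set.range fun φ : UCP n A => φ.comp (StarAlgHom.fst ℂ A B))
      (Set.range fun ψ : UCP n B => ψ.comp (StarAlgHom.snd ℂ A B))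

/-- The action of a ⋆-isomorphism on self-adjoint elements. -/
def mapSelfAdjoint {A B : Type*} [CStarAlgebra A] [CStarAlgebra B] (Φ : A ≃⋆ₐ[ℂ] B)
    (a : selfAdjoint A) : selfAdjoint B :=
  ⟨Φ a, selfAdjoint.mem_iff.mpr ((map_star Φ (a : A)).symm.trans (congrArg Φ a.2))⟩

end QuantumMetric

end

noncomputable section

namespace QuantumMetric

/-! ### Positivity, states and norms in a C⋆-algebra. -/

section Order

variable {A : Type*} [CStarAlgebra A] [PartialOrder A] [StarOrderedRing A]

/-! Distance zero gives seminorms `M k` on `A_sa ⊕ B_sa`, inducing `LA` and `LB`, for which the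
second matricial state spaces are `1/(k+1)`-close (`exists_asymptoticBridge`). Call `a` and `b`
related (`LimRel`) when they are limits, along a fixed ultrafilter, of pairs on which `M k` stays
bounded: errors `r/(k+1)` then vanish, so every matricial state of one algebra is a limit of
matricial states of the other, simultaneously on all related pairs.

Testing against states, the relation preserves positivity, hence is contractive and single-valued in
both directions (`limRel_nonneg`, `limRel_norm_le`). It is total because norm-bounded Lip-balls are
relatively compact (`IsLipNorm.exists_tendsto`) and domains are dense. Choosing partners with `M k a
b` close to `LA a` also controls `LB` of the partner, which yields the equality of closures
(`lipClosure_le`).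

So far states suffice, but an order isomorphism need not be multiplicative. This is where size 2
enters: in the GNS space of a state `μ`, two dimensions hold both the cyclic vector `ξ` and `xξ`, so
the first column of a matricial state computes `μ(x⋆x)` exactly (`exists_ucp_two_column`).
Approximating it from the other algebra and applying Kadison–Schwarz there gives `x⋆x ≤
Φ⁻¹(Φ(x)⋆Φ(x))`. The mirror inequality turns this into equality, and polarization gives products. -/

theorem exists_eq_star_mul_self {h : A} (hh : 0 ≤ h) : ∃ x, h = star x * x :=
  CStarAlgebra.nonneg_iff_eq_star_mul_self.mp hh

theorem norm_le_of_neg_algebraMap_le_of_le {h : A} (hh : IsSelfAdjoint h) {r : ℝ} (hr : 0 ≤ r)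
    (h₁ : -algebraMap ℝ A r ≤ h) (h₂ : h ≤ algebraMap ℝ A r) : ‖h‖ ≤ r := by
  obtain _ | _ := subsingleton_or_nontrivial A
  · simpa [Subsingleton.elim h 0] using hr
  · rw [← map_neg, algebraMap_le_iff_le_spectrum] at h₁
    rw [le_algebraMap_iff_spectrum_le] at h₂
    rcases CStarAlgebra.norm_or_neg_norm_mem_spectrum (a := h) with hs | hs
    · exact h₂ _ hs
    · linarith [h₁ _ hs]

theorem norm_map_le_of_isSelfAdjoint {C F : Type*} [CStarAlgebra C] [PartialOrder C]
    [StarOrderedRing C] [FunLike F A C] [LinearMapClass F ℂ A C] [OrderHomClass F A C] (f : F)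
    (hf : f 1 = 1) {h : A} (hh : IsSelfAdjoint h) : ‖f h‖ ≤ ‖h‖ := by
  have key : f (algebraMap ℝ A ‖h‖) = algebraMap ℝ C ‖h‖ := by
    rw [Algebra.algebraMap_eq_smul_one, Algebra.algebraMap_eq_smul_one, ← Complex.coe_smul,
      map_smul, hf, Complex.coe_smul]
  refine norm_le_of_neg_algebraMap_le_of_le (hh.map f) (norm_nonneg h) ?_ ?_
  · rw [← key, ← map_neg]
    exact OrderHomClass.mono f hh.neg_algebraMap_norm_le_self
  · rw [← key]
    exact OrderHomClass.mono f hh.le_algebraMap_norm_self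

/-- The crude constant is enough: it only serves to bound the state space for Banach–Alaoglu. -/
theorem norm_map_le_two_mul {C F : Type*} [CStarAlgebra C] [PartialOrder C]
    [StarOrderedRing C] [FunLike F A C] [LinearMapClass F ℂ A C] [OrderHomClass F A C] (f : F)
    (hf : f 1 = 1) (x : A) : ‖f x‖ ≤ 2 * ‖x‖ := by
  calc ‖f x‖ = ‖f (realPart x : A) + Complex.I • f (imaginaryPart x : A)‖ := by
        rw [← map_smul, ← map_add, realPart_add_I_smul_imaginaryPart]
    _ ≤ ‖f (realPart x : A)‖ + ‖Complex.I • f (imaginaryPart x : A)‖ := norm_add_le _ _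
    _ ≤ ‖(realPart x : A)‖ + ‖(imaginaryPart x : A)‖ := by
        rw [norm_smul, Complex.norm_I, one_mul]
        exact add_le_add (norm_map_le_of_isSelfAdjoint f hf (realPart x).2)
          (norm_map_le_of_isSelfAdjoint f hf (imaginaryPart x).2)
    _ ≤ ‖x‖ + ‖x‖ := add_le_add (realPart.norm_le x) (imaginaryPart.norm_le x)
    _ = 2 * ‖x‖ := by ring

/-- A self-adjoint element that is not positive is detected by a state. -/
theorem exists_state_re_neg {h : A} (hh : IsSelfAdjoint h) (hneg : ¬ 0 ≤ h) :
    ∃ μ : A →ₚ[ℂ] ℂ, μ 1 = 1 ∧ (μ h).re < 0 := by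
  obtain ⟨f, hf, hfh⟩ := (ProperCone.positive ℝ A).hyperplane_separation_point
    (x₀ := h) (by simpa using hneg)
  have hf' : ∀ x : A, 0 ≤ x → 0 ≤ f x := fun x hx => hf x (by simpa using hx)
  -- The separating functional is only real-linear; precomposing with the real part lets its complex
  -- extension agree with `f` on self-adjoint elements.
  let g : Module.Dual ℝ A :=
    f.toLinearMap ∘ₗ (selfAdjoint.submodule ℝ A).subtype ∘ₗ (realPart : A →ₗ[ℝ] selfAdjoint A)
  have hg : ∀ x : A, g x = f (realPart x : A) := fun x => rfl
  have hval : ∀ x : A, IsSelfAdjoint x → g.extendRCLike (𝕜 := ℂ) x = (f x : ℂ) := by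
    intro x hx
    rw [Module.Dual.extendRCLike_apply, hg, hg, hx.coe_realPart]
    have : realPart ((RCLike.I : ℂ) • x) = 0 := by
      have := realPart_I_smul x
      rw [hx.imaginaryPart, neg_zero] at this
      exact this
    rw [this]
    simp
  let ν : A →ₚ[ℂ] ℂ := PositiveLinearMap.mk₀ (g.extendRCLike (𝕜 := ℂ)) fun x hx => by
    rw [hval x (.of_nonneg hx)]
    exact_mod_cast hf' x hx
  have hν : ∀ x, IsSelfAdjoint x → ν x = (f x : ℂ) := hval
  -- If `f 1 = 0`, positivity of `h + ‖h‖` forces `0 ≤ f h`, against the separation. Hence `f` can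
  -- be normalized.
  have h1 : 0 < f 1 := by
    by_contra hcon
    have h0 : f 1 = 0 := le_antisymm (not_lt.mp hcon) (hf' 1 zero_le_one)
    have := hf' (h + algebraMap ℝ A ‖h‖) (by
      have := hh.neg_algebraMap_norm_le_self
      rwa [neg_le_iff_add_nonneg] at this)
    rw [Algebra.algebraMap_eq_smul_one, map_add, map_smul, h0] at this
    simp at this
    linarith
  refine ⟨PositiveLinearMap.mk₀ (((f 1 : ℂ)⁻¹) • ν.toLinearMap) fun x hx => ?_, ?_, ?_⟩
  · have : (0 : ℂ) ≤ (f 1 : ℂ)⁻¹ := by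
      rw [← Complex.ofReal_inv]
      exact_mod_cast (inv_pos.mpr h1).le
    exact mul_nonneg this (ν.map_nonneg hx)
  · change (f 1 : ℂ)⁻¹ * ν 1 = 1
    rw [hν 1 (.one A)]
    exact inv_mul_cancel₀ (by exact_mod_cast h1.ne')
  · change ((f 1 : ℂ)⁻¹ * ν h).re < 0
    rw [hν h hh, ← Complex.ofReal_inv, ← Complex.ofReal_mul, Complex.ofReal_re]
    exact mul_neg_of_pos_of_neg (inv_pos.mpr h1) hfh

theorem nonneg_of_forall_state {h : A} (hh : IsSelfAdjoint h)
    (H : ∀ μ : A →ₚ[ℂ] ℂ, μ 1 = 1 → 0 ≤ (μ h).re) : 0 ≤ h := by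
  by_contra hneg
  obtain ⟨μ, hμ, hlt⟩ := exists_state_re_neg hh hneg
  exact (H μ hμ).not_gt hlt

omit [StarOrderedRing A] in
theorem state_algebraMap (μ : A →ₚ[ℂ] ℂ) (hμ : μ 1 = 1) (r : ℝ) : μ (algebraMap ℝ A r) = r := by
  rw [Algebra.algebraMap_eq_smul_one, ← Complex.coe_smul, map_smul, hμ]
  simp

theorem norm_le_of_forall_state {h : A} (hh : IsSelfAdjoint h) {r : ℝ} (hr : 0 ≤ r)
    (H : ∀ μ : A →ₚ[ℂ] ℂ, μ 1 = 1 → ‖μ h‖ ≤ r) : ‖h‖ ≤ r := by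
  have hsa : IsSelfAdjoint (algebraMap ℝ A r) := IsSelfAdjoint.algebraMap A (.all r)
  refine norm_le_of_neg_algebraMap_le_of_le hh hr ?_ ?_
  · rw [neg_le_iff_add_nonneg]
    refine nonneg_of_forall_state (hh.add hsa) fun μ hμ => ?_
    rw [map_add, state_algebraMap μ hμ, Complex.add_re, Complex.ofReal_re]
    linarith [(abs_le.mp ((Complex.abs_re_le_norm _).trans (H μ hμ))).1]
  · rw [← sub_nonneg]
    refine nonneg_of_forall_state (hsa.sub hh) fun μ hμ => ?_
    rw [map_sub, state_algebraMap μ hμ, Complex.sub_re, Complex.ofReal_re]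
    linarith [(abs_le.mp ((Complex.abs_re_le_norm _).trans (H μ hμ))).2]

end Order

/-! ### Positivity of matrices over a C⋆-algebra. -/

section Matrix

variable {A : Type*} [CStarAlgebra A] [PartialOrder A] [StarOrderedRing A]

theorem cstarMatrix_diag_nonneg {n : Type*} [Fintype n] [DecidableEq n] {M : CStarMatrix n n A} (hM : 0 ≤ M)
    (i : n) : 0 ≤ M i i := by
  obtain ⟨N, rfl⟩ := exists_eq_star_mul_self hM
  rw [CStarMatrix.mul_apply]
  refine Finset.sum_nonneg fun j _ => ?_
  rw [CStarMatrix.star_apply]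
  exact star_mul_self_nonneg _

open scoped MatrixOrder Matrix.Norms.L2Operator in
theorem exists_conjTranspose_mul_self {ι : Type*} [Fintype ι] [DecidableEq ι]
    {M : Matrix ι ι ℂ} (hM : M.PosSemidef) : ∃ N : Matrix ι ι ℂ, M = N.conjTranspose * N :=
  CStarAlgebra.nonneg_iff_eq_star_mul_self.mp (Matrix.nonneg_iff_posSemidef.mpr hM)

/-- Block Gram matrices of a positive functional are positive. -/
theorem gram_nonneg (μ : A →ₚ[ℂ] ℂ) {k n : Type*} [Fintype k] [Fintype n] [DecidableEq k]
    [DecidableEq n] (y : k → n → A) :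
    (0 : CStarMatrix k k (CStarMatrix n n ℂ)) ≤
      CStarMatrix.ofMatrix fun p q => CStarMatrix.ofMatrix fun i j =>
        μ (star (y p i) * y q j) := by
  -- Flattening the blocks gives an ordinary Gram matrix; its factor `N`, cut back into blocks,
  -- exhibits the block matrix as `star K * K`.
  let G : Matrix (k × n) (k × n) ℂ := fun a b => μ (star (y a.1 a.2) * y b.1 b.2)
  have hG : G.PosSemidef := by
    refine Matrix.PosSemidef.of_dotProduct_mulVec_nonneg ?_ fun z => ?_
    · ext a b
      change star (μ _) = μ _
      rw [← map_star, star_mul, star_star]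
    · have : star z ⬝ᵥ G.mulVec z =
          μ (star (∑ a, z a • y a.1 a.2) * ∑ a, z a • y a.1 a.2) := by
        rw [star_sum, Finset.sum_mul_sum]
        simp only [dotProduct, Matrix.mulVec, map_sum, Pi.star_apply, Finset.mul_sum, star_smul,
          smul_mul_smul_comm, map_smul, smul_eq_mul, G]
        refine Finset.sum_congr rfl fun a _ => Finset.sum_congr rfl fun b _ => ?_
        ring
      rw [this]
      exact μ.map_nonneg (star_mul_self_nonneg _)
  obtain ⟨N, hN⟩ := exists_conjTranspose_mul_self hG
  let K : CStarMatrix k k (CStarMatrix n n ℂ) :=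
    CStarMatrix.ofMatrix fun p q => CStarMatrix.ofMatrix fun i j => N (p, i) (q, j)
  have : (CStarMatrix.ofMatrix fun p q => CStarMatrix.ofMatrix fun i j =>
        μ (star (y p i) * y q j)) = star K * K := by
    refine CStarMatrix.ext fun p q => CStarMatrix.ext fun i j => ?_
    have h1 : μ (star (y p i) * y q j) = ∑ a, star (N a (p, i)) * N a (q, j) :=
      congrFun (congrFun hN (p, i)) (q, j)
    rw [CStarMatrix.mul_apply]
    have h2 : ∀ r, (star K p r * K r q) i j = ∑ l, star (N (r, l) (p, i)) * N (r, l) (q, j) :=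
      fun r => rfl
    have h3 : ∀ f : k → CStarMatrix n n ℂ, (∑ r, f r) i j = ∑ r, f r i j := fun f =>
      (congrFun (Finset.sum_apply i Finset.univ (f : k → n → n → ℂ)) j).trans
        (Finset.sum_apply j _ _)
    rw [h3]
    simp only [h2]
    rw [← Fintype.sum_prod_type' (f := fun r l => star (N (r, l) (p, i)) * N (r, l) (q, j))]
    exact h1
  rw [this]
  exact star_mul_self_nonneg _

end Matrix

/-! ### Matricial states from compressions, and Kadison–Schwarz. -/

section

variable {A : Type*} [CStarAlgebra A] [PartialOrder A] [StarOrderedRing A]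

/-- The linear map `x ↦ (∑ₜ μ(vₜᵢ* x vₜⱼ))ᵢⱼ` into `M_n(ℂ)`. -/
def compressionₗ (μ : A →ₚ[ℂ] ℂ) {n T : ℕ} (v : Fin T → Fin n → A) :
    A →ₗ[ℂ] CStarMatrix (Fin n) (Fin n) ℂ where
  toFun x := CStarMatrix.ofMatrix fun i j => ∑ t, μ (star (v t i) * x * v t j)
  map_add' x y := by
    refine CStarMatrix.ext fun i j => ?_
    change ∑ t, μ (star (v t i) * (x + y) * v t j) =
      ∑ t, μ (star (v t i) * x * v t j) + ∑ t, μ (star (v t i) * y * v t j)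
    simp only [mul_add, add_mul, map_add, Finset.sum_add_distrib]
  map_smul' c x := by
    refine CStarMatrix.ext fun i j => ?_
    change ∑ t, μ (star (v t i) * (c • x) * v t j) = c * ∑ t, μ (star (v t i) * x * v t j)
    simp only [mul_smul_comm, smul_mul_assoc, map_smul, smul_eq_mul, Finset.mul_sum]

/-- The completely positive map `x ↦ (∑ₜ μ(vₜᵢ* x vₜⱼ))ᵢⱼ`. -/
def compression (μ : A →ₚ[ℂ] ℂ) {n T : ℕ} (v : Fin T → Fin n → A) :
    A →CP CStarMatrix (Fin n) (Fin n) ℂ where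
  toLinearMap := compressionₗ μ v
  map_cstarMatrix_nonneg' k M hM := by
    obtain ⟨N, rfl⟩ := exists_eq_star_mul_self hM
    have : (star N * N).map (compressionₗ μ v) =
        ∑ r, ∑ t, CStarMatrix.ofMatrix fun p q => CStarMatrix.ofMatrix fun i j =>
          μ (star (N r p * v t i) * (N r q * v t j)) := by
      refine CStarMatrix.ext fun p q => ?_
      have h3 : ∀ {m : ℕ} (f : Fin m → CStarMatrix (Fin k) (Fin k)
          (CStarMatrix (Fin n) (Fin n) ℂ)), (∑ r, f r) p q = ∑ r, f r p q := fun f =>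
        (congrFun (Finset.sum_apply p Finset.univ
          (f : _ → Fin k → Fin k → CStarMatrix (Fin n) (Fin n) ℂ)) q).trans
          (Finset.sum_apply q _ _)
      simp only [CStarMatrix.map_apply, CStarMatrix.mul_apply, map_sum, h3]
      refine Finset.sum_congr rfl fun r _ => CStarMatrix.ext fun i j => ?_
      have h4 : ∀ (f : Fin T → CStarMatrix (Fin n) (Fin n) ℂ), (∑ r, f r) i j = ∑ r, f r i j :=
        fun f => (congrFun (Finset.sum_apply i Finset.univ (f : _ → Fin n → Fin n → ℂ)) j).trans
          (Finset.sum_apply j _ _)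
      rw [h4]
      change ∑ t, μ (star (v t i) * (star (N r p) * N r q) * v t j) =
        ∑ t, μ (star (N r p * v t i) * (N r q * v t j))
      simp only [star_mul, mul_assoc]
    rw [this]
    exact Finset.sum_nonneg fun r _ => Finset.sum_nonneg fun t _ =>
      gram_nonneg μ fun p i => N r p * v t i

theorem compression_apply (μ : A →ₚ[ℂ] ℂ) {n T : ℕ} (v : Fin T → Fin n → A) (x : A)
    (i j : Fin n) : compression μ v x i j = ∑ t, μ (star (v t i) * x * v t j) := rfl

/-- Every state is the diagonal entry of a matricial state. -/
theorem exists_ucp_eq_diagonal (n : ℕ) (μ : A →ₚ[ℂ] ℂ) (hμ : μ 1 = 1) :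
    ∃ φ : UCP n A, ∀ x i j, φ.1 x i j = if i = j then μ x else 0 := by
  have key : ∀ x i j, compression μ (fun t i : Fin n => if t = i then (1 : A) else 0) x i j =
      if i = j then μ x else 0 := by
    intro x i j
    rw [compression_apply, Finset.sum_eq_single i]
    · by_cases hij : i = j <;> simp [hij]
    · intro t _ hti
      simp [hti]
    · simp
  refine ⟨⟨compression μ fun t i => if t = i then 1 else 0, CStarMatrix.ext fun i j => ?_⟩, key⟩
  rw [key, hμ]
  rfl

/-- For every state `μ` and every `x` there is a `2`-dimensional compression of the GNS
representation of `μ` that contains the cyclic vector and its image under `x`. -/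
theorem exists_ucp_two_column (μ : A →ₚ[ℂ] ℂ) (hμ : μ 1 = 1) (x : A) :
    ∃ φ : UCP 2 A, (∀ y, φ.1 y 0 0 = μ y) ∧
      ‖φ.1 x 0 0‖ ^ 2 + ‖φ.1 x 1 0‖ ^ 2 = (μ (star x * x)).re := by
  -- Gram–Schmidt in the GNS space: `c` is the part of `x` orthogonal to the cyclic vector, and `s`
  -- below is its squared length.
  set c : A := x - algebraMap ℂ A (μ x) with hc
  have hμc : μ c = 0 := by
    rw [hc, map_sub, Algebra.algebraMap_eq_smul_one, map_smul, hμ]; simp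
  have hμc' : μ (star c) = 0 := by rw [map_star, hμc, star_zero]
  have hx : x = c + μ x • 1 := by rw [hc, Algebra.algebraMap_eq_smul_one]; abel
  have hcc : 0 ≤ μ (star c * c) := μ.map_nonneg (star_mul_self_nonneg c)
  obtain ⟨s, hs, hs'⟩ : ∃ s : ℝ, 0 ≤ s ∧ μ (star c * c) = s :=
    ⟨(μ (star c * c)).re, (Complex.nonneg_iff.mp hcc).1,
      (Complex.ext rfl (by simpa using (Complex.nonneg_iff.mp hcc).2.symm))⟩
  have hcx : μ (star c * x) = s := by
    conv_lhs => rw [hx]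
    rw [mul_add, mul_smul_comm, mul_one, map_add, map_smul, hμc', hs', smul_zero, add_zero]
  have hxx : (μ (star x * x)).re = ‖μ x‖ ^ 2 + s := by
    have : star x * x = star c * x + (star (μ x)) • x := by
      conv_lhs => rw [hx, star_add, star_smul, star_one, ← hx]
      rw [add_mul, smul_mul_assoc, one_mul]
    rw [this, map_add, map_smul, hcx, smul_eq_mul, Complex.star_def, Complex.conj_mul']
    rw [Complex.add_re, Complex.ofReal_re, ← Complex.ofReal_pow, Complex.ofReal_re, add_comm]
  -- If `s = 0`, then `x` acts on the cyclic vector as a scalar and there is no second direction to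
  -- normalize; the diagonal matricial state already works.
  rcases hs.eq_or_lt with h0 | hpos
  · obtain ⟨φ, hφ⟩ := exists_ucp_eq_diagonal 2 μ hμ
    refine ⟨φ, fun y => by simp [hφ], ?_⟩
    rw [hφ, hφ, hxx, ← h0]
    simp
  · set r : ℂ := (((Real.sqrt s)⁻¹ : ℝ) : ℂ) with hr
    have hrr : r * r * s = 1 := by
      rw [hr, ← Complex.ofReal_mul, ← Complex.ofReal_mul, ← mul_inv, Real.mul_self_sqrt hs,
        inv_mul_cancel₀ hpos.ne', Complex.ofReal_one]
    have hrs : star r = r := Complex.conj_ofReal _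
    let v : Fin 1 → Fin 2 → A := fun _ => ![1, r • c]
    refine ⟨⟨compression μ v, CStarMatrix.ext fun i j => ?_⟩, fun y => ?_, ?_⟩
    · rw [compression_apply]
      fin_cases i <;> fin_cases j <;>
        simp [v, hμ, hμc, hμc', hs']
      have : r * (star r * s) = 1 := by rw [hrs, ← mul_assoc]; exact hrr
      simpa using this
    · simp [compression_apply, v]
    · have h00 : compression μ v x 0 0 = μ x := by simp [compression_apply, v]
      have h10 : compression μ v x 1 0 = r * s := by
        simp [compression_apply, v, hcx]
        left
        exact hrs
      change ‖compression μ v x 0 0‖ ^ 2 + ‖compression μ v x 1 0‖ ^ 2 = _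
      rw [h00, h10, hxx, hr, ← Complex.ofReal_mul, Complex.norm_real, Real.norm_eq_abs, sq_abs,
        mul_pow, inv_pow, Real.sq_sqrt hs]
      field_simp

theorem UCP.norm_apply_le_of_isSelfAdjoint {n : ℕ} (φ : UCP n A) {x : A} (hx : IsSelfAdjoint x)
    (i j : Fin n) : ‖φ.1 x i j‖ ≤ ‖x‖ :=
  CStarMatrix.norm_entry_le_norm.trans (norm_map_le_of_isSelfAdjoint φ.1 φ.2 hx)

theorem UCP.realPart_add_I_mul_imaginaryPart {n : ℕ} (φ : UCP n A) (x : A) (i j : Fin n) :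
    φ.1 (realPart x : A) i j + Complex.I * φ.1 (imaginaryPart x : A) i j = φ.1 x i j := by
  conv_rhs => rw [← _root_.realPart_add_I_smul_imaginaryPart x, map_add, map_smul]
  rfl

/-- A Schur complement argument: `N⋆N` has rows `(x⋆x, x⋆)` and `(x, 1)`. Apply `φ` entrywise and
compress to the column `(1, -φ(x))`; the resulting corner is the difference of the two sides. -/
theorem UCP.star_mul_self_le {n : ℕ} (φ : UCP n A) (x : A) :
    star (φ.1 x) * φ.1 x ≤ φ.1 (star x * x) := by
  let N : CStarMatrix (Fin 2) (Fin 2) A := CStarMatrix.ofMatrix !![x, 1; 0, 0]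
  have hN := φ.1.map_cstarMatrix_nonneg _ (star_mul_self_nonneg N)
  let W : CStarMatrix (Fin 2) (Fin 2) (CStarMatrix (Fin n) (Fin n) ℂ) :=
    CStarMatrix.ofMatrix !![1, 0; -φ.1 x, 0]
  have h := cstarMatrix_diag_nonneg (star_left_conjugate_nonneg hN W) 0
  have h00 : (star N * N) 0 0 = star x * x := by
    simp [CStarMatrix.mul_apply, CStarMatrix.star_apply, N]
  have h01 : (star N * N) 0 1 = star x := by
    simp [CStarMatrix.mul_apply, CStarMatrix.star_apply, N]
  have h10 : (star N * N) 1 0 = x := by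
    simp [CStarMatrix.mul_apply, CStarMatrix.star_apply, N]
  have h11 : (star N * N) 1 1 = 1 := by
    simp [CStarMatrix.mul_apply, CStarMatrix.star_apply, N]
  rw [CStarMatrix.mul_apply, Fin.sum_univ_two, CStarMatrix.mul_apply, CStarMatrix.mul_apply,
    Fin.sum_univ_two, Fin.sum_univ_two] at h
  simp only [CStarMatrix.star_apply, CStarMatrix.map_apply, h00, h01, h10, h11, φ.2, map_star] at h
  have e : star (φ.1 x) * φ.1 x ≤ φ.1 (star x * x) ↔
      0 ≤ φ.1 (star x * x) - star (φ.1 x) * φ.1 x := sub_nonneg.symm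
  rw [e]
  convert h using 1
  simpa [W] using sub_eq_add_neg _ _

/-- The Kadison–Schwarz inequality for a matricial state, read off at a diagonal entry. -/
theorem UCP.sum_norm_sq_le {n : ℕ} (φ : UCP n A) (x : A) (j : Fin n) :
    ∑ i, ‖φ.1 x i j‖ ^ 2 ≤ (φ.1 (star x * x) j j).re := by
  have h := cstarMatrix_diag_nonneg (sub_nonneg.mpr (φ.star_mul_self_le x)) j
  rw [CStarMatrix.sub_apply, CStarMatrix.mul_apply] at h
  have h' := (Complex.nonneg_iff.mp h).1
  rw [Complex.sub_re, sub_nonneg, Complex.re_sum] at h'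
  refine le_of_eq_of_le (Finset.sum_congr rfl fun i _ => ?_) h'
  rw [CStarMatrix.star_apply, Complex.star_def, Complex.conj_mul', ← Complex.ofReal_pow,
    Complex.ofReal_re]

end

/-! ### Compactness of the state space and of bounded Lip-balls. -/

section

variable {A : Type*} [CStarAlgebra A] [PartialOrder A] [StarOrderedRing A]

/-- A point of the state space as a positive linear functional. -/
def toPositive (μ : stateSpace A) : A →ₚ[ℂ] ℂ :=
  PositiveLinearMap.mk₀ (μ.1 : A →L[ℂ] ℂ).toLinearMap μ.2.1

theorem exists_stateSpace_eq (ν : A →ₚ[ℂ] ℂ) (hν : ν 1 = 1) :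
    ∃ μ : stateSpace A, ∀ a, μ.1 a = ν a :=
  ⟨⟨StrongDual.toWeakDual (⟨ν.toLinearMap, map_continuous ν⟩ : StrongDual ℂ A),
    fun _ ha => ν.map_nonneg ha, hν⟩, fun _ => rfl⟩

theorem isCompact_stateSpace : IsCompact (stateSpace A) := by
  refine WeakDual.isCompact_of_bounded_of_closed ?_ ?_
  · refine (WeakDual.isBounded_closedBall (0 : StrongDual ℂ A) 2).subset fun μ hμ => ?_
    rw [Set.mem_preimage, mem_closedBall_zero_iff]
    refine ContinuousLinearMap.opNorm_le_bound _ zero_le_two fun a => ?_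
    exact norm_map_le_two_mul (toPositive ⟨μ, hμ⟩) hμ.2 a
  · have : stateSpace A = (⋂ (a : A) (_ : 0 ≤ a), {μ : WeakDual ℂ A | 0 ≤ μ a}) ∩
        {μ : WeakDual ℂ A | μ 1 = 1} := by
      ext μ
      simp [stateSpace]
    rw [this]
    refine IsClosed.inter (isClosed_iInter fun a => isClosed_iInter fun _ => ?_) ?_
    · exact isClosed_Ici.preimage (WeakDual.eval_continuous a)
    · exact isClosed_singleton.preimage (WeakDual.eval_continuous (1 : A))

/-- The state space has finite `ρ_L`-nets. -/
theorem IsLipNorm.exists_finite_net {L : selfAdjoint A → ℝ≥0∞} (hL : IsLipNorm L) {δ : ℝ}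
    (hδ : 0 < δ) : ∃ t : Finset (stateSpace A), ∀ ν : stateSpace A, ∃ μ ∈ t,
      ∀ a : selfAdjoint A, L a ≤ 1 → ‖ν.1 (a : A) - μ.1 (a : A)‖ ≤ δ := by
  have : CompactSpace (stateSpace A) := isCompact_iff_compactSpace.mp isCompact_stateSpace
  let U : stateSpace A → Set (stateSpace A) := fun μ =>
    {ν | (stateMetric L).edist ν μ < ENNReal.ofReal δ}
  -- Here the Lip-norm axiom enters: `ρ_L`-balls are weak-⋆ neighbourhoods, so compactness yields a
  -- finite net.
  have hU : ∀ μ : stateSpace A, U μ ∈ 𝓝 μ := by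
    intro μ
    have h : U μ ∈ @nhds _ (stateMetric L).toUniformSpace.toTopologicalSpace μ :=
      letI := stateMetric L
      Metric.eball_mem_nhds μ (ENNReal.ofReal_pos.mpr hδ)
    rwa [hL.topology_eq] at h
  obtain ⟨t, -, ht⟩ := isCompact_univ.elim_nhds_subcover U fun μ _ => hU μ
  refine ⟨t, fun ν => ?_⟩
  obtain ⟨μ, hμ, hνμ⟩ := Set.mem_iUnion₂.mp (ht (Set.mem_univ ν))
  refine ⟨μ, hμ, fun a ha => ?_⟩
  have h1 : edist (ν.1 (a : A)) (μ.1 (a : A)) ≤ ENNReal.ofReal δ :=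
    (le_iSup₂ (f := fun (a : selfAdjoint A) (_ : L a ≤ 1) =>
      edist (ν.1 (a : A)) (μ.1 (a : A))) a ha).trans (le_of_lt hνμ)
  rw [edist_dist, dist_eq_norm] at h1
  exact (ENNReal.ofReal_le_ofReal_iff hδ.le).mp h1

theorem enorm_inv_mul_le_one {r : ℝ} (hr : 0 < r) {x : ℝ≥0∞} (hx : x ≤ ENNReal.ofReal r) :
    ‖r⁻¹‖ₑ * x ≤ 1 := by
  refine (mul_le_mul_right hx _).trans ?_
  rw [Real.enorm_eq_ofReal (inv_nonneg.mpr hr.le), ← ENNReal.ofReal_mul (inv_nonneg.mpr hr.le),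
    inv_mul_cancel₀ hr.ne', ENNReal.ofReal_one]

instance : CompleteSpace (selfAdjoint A) :=
  (isClosed_eq continuous_star continuous_id : IsClosed {a : A | star a = a}).completeSpace_coe

/-- Balls of a Lip-norm that are bounded in norm are relatively compact. -/
theorem IsLipNorm.exists_tendsto {L : selfAdjoint A → ℝ≥0∞} (hL : IsLipNorm L) {ι : Type*}
    (U : Ultrafilter ι) {b : ι → selfAdjoint A} {r M : ℝ} (hr : 0 < r)
    (hb : ∀ k, L (b k) ≤ ENNReal.ofReal r) (hM : ∀ k, ‖b k‖ ≤ M) :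
    ∃ b₀, Filter.Tendsto b U (𝓝 b₀) := by
  refine cauchy_map_iff_exists_tendsto.mp (Metric.cauchy_iff.mpr ⟨inferInstance, fun ε hε => ?_⟩)
  -- On the ball of radius `r` this net has error `ε/6`. Two such errors plus `ε/6` for the
  -- variation at a net point give `ε/2`.
  obtain ⟨t, ht⟩ := hL.exists_finite_net (δ := ε / (6 * r)) (by positivity)
  have hloc : ∀ μ : stateSpace A, ∃ z : ℂ, Filter.Tendsto (fun k => μ.1 (b k : A)) U (𝓝 z) := by
    intro μ
    have hmem : ∀ k, μ.1 (b k : A) ∈ Metric.closedBall (0 : ℂ) M := fun k => by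
      rw [mem_closedBall_zero_iff]
      exact (norm_map_le_of_isSelfAdjoint (toPositive μ) μ.2.2 (b k).2).trans (hM k)
    obtain ⟨z, -, hz⟩ := (isCompact_closedBall (0 : ℂ) M).ultrafilter_le_nhds
      (U.map fun k => μ.1 (b k : A)) (by
        rw [Filter.le_principal_iff]
        exact Filter.mem_map.mpr (Filter.univ_mem' hmem))
    exact ⟨z, hz⟩
  choose z hz using hloc
  have hev : ∀ᶠ k in (U : Filter ι), ∀ μ ∈ t, dist (μ.1 (b k : A)) (z μ) < ε / 12 :=
    (Filter.eventually_all_finset t).mpr fun μ _ =>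
      (hz μ).eventually (Metric.ball_mem_nhds _ (by positivity))
  refine ⟨b '' {k | ∀ μ ∈ t, dist (μ.1 (b k : A)) (z μ) < ε / 12}, Filter.image_mem_map hev, ?_⟩
  rintro _ ⟨k, hk, rfl⟩ _ ⟨l, hl, rfl⟩
  suffices ‖((b k - b l : selfAdjoint A) : A)‖ ≤ ε / 2 by
    rw [dist_eq_norm]
    exact lt_of_le_of_lt this (by linarith)
  refine norm_le_of_forall_state (b k - b l).2 (by positivity) fun ν hν => ?_
  obtain ⟨ν', hν'⟩ := exists_stateSpace_eq ν hν
  obtain ⟨μ, hμ, hνμ⟩ := ht ν'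
  have hclose : ∀ k, ‖ν (b k : A) - μ.1 (b k : A)‖ ≤ ε / 6 := by
    intro k
    have := hνμ (r⁻¹ • b k) (by rw [hL.smul]; exact enorm_inv_mul_le_one hr (hb k))
    rw [hν', selfAdjoint.val_smul, ← Complex.coe_smul, map_smul, map_smul, ← smul_sub, norm_smul,
      Complex.norm_real, Real.norm_eq_abs, abs_of_pos (inv_pos.mpr hr), inv_mul_le_iff₀ hr] at this
    refine this.trans_eq ?_
    field_simp
  have hkl : ‖μ.1 (b k : A) - μ.1 (b l : A)‖ ≤ ε / 6 := by
    rw [← dist_eq_norm]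
    linarith [dist_triangle_right (μ.1 (b k : A)) (μ.1 (b l : A)) (z μ), hk μ hμ, hl μ hμ]
  have e : ν ((b k - b l : selfAdjoint A) : A) = (ν (b k : A) - μ.1 (b k : A)) +
      (μ.1 (b k : A) - μ.1 (b l : A)) - (ν (b l : A) - μ.1 (b l : A)) := by
    rw [AddSubgroupClass.coe_sub, map_sub]
    ring
  rw [e]
  refine (norm_sub_le _ _).trans ?_
  linarith [norm_add_le (ν (b k : A) - μ.1 (b k : A)) (μ.1 (b k : A) - μ.1 (b l : A)),
    hclose k, hclose l]

end

/-! ### The limit relation on self-adjoint elements. -/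

section

variable {A B : Type*} [CStarAlgebra A] [PartialOrder A] [StarOrderedRing A]
  [CStarAlgebra B] [PartialOrder B] [StarOrderedRing B]

/-- A sequence of seminorms on `A_sa ⊕ B_sa` inducing `LA` and `LB` for which the second matricial
state spaces of `A` and `B` become arbitrarily close to each other. -/
structure AsymptoticBridge (LA : selfAdjoint A → ℝ≥0∞) (LB : selfAdjoint B → ℝ≥0∞)
    (M : ℕ → selfAdjoint A → selfAdjoint B → ℝ≥0∞) : Prop where
  add_le (k : ℕ) (a a' : selfAdjoint A) (b b' : selfAdjoint B) :
    M k (a + a') (b + b') ≤ M k a b + M k a' b'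
  smul (k : ℕ) (r : ℝ) (a : selfAdjoint A) (b : selfAdjoint B) :
    M k (r • a) (r • b) = ‖r‖ₑ * M k a b
  map_one (k : ℕ) : M k 1 1 = 0
  quotient_left (k : ℕ) (a : selfAdjoint A) : LA a = ⨅ b, M k a b
  quotient_right (k : ℕ) (b : selfAdjoint B) : LB b = ⨅ a, M k a b
  close_left (k : ℕ) (φ : UCP 2 A) : ∃ ψ : UCP 2 B, ∀ (a : selfAdjoint A) (b : selfAdjoint B),
    M k a b ≤ 1 → ‖φ.1 (a : A) - ψ.1 (b : B)‖ ≤ 1 / (k + 1 : ℝ)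
  close_right (k : ℕ) (ψ : UCP 2 B) : ∃ φ : UCP 2 A, ∀ (a : selfAdjoint A) (b : selfAdjoint B),
    M k a b ≤ 1 → ‖φ.1 (a : A) - ψ.1 (b : B)‖ ≤ 1 / (k + 1 : ℝ)

/-- `a` and `b` are limits, along the hyperfilter, of pairs on which the seminorms `M k` stay
bounded. -/
def LimRel (M : ℕ → selfAdjoint A → selfAdjoint B → ℝ≥0∞) (a : selfAdjoint A)
    (b : selfAdjoint B) : Prop :=
  ∀ δ > 0, ∃ r : ℝ, 0 < r ∧ ∀ᶠ k in (Filter.hyperfilter ℕ : Filter ℕ),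
    ∃ a' b', M k a' b' ≤ ENNReal.ofReal r ∧ ‖a' - a‖ ≤ δ ∧ ‖b' - b‖ ≤ δ

variable {LA : selfAdjoint A → ℝ≥0∞} {LB : selfAdjoint B → ℝ≥0∞}
  {M : ℕ → selfAdjoint A → selfAdjoint B → ℝ≥0∞}

omit [PartialOrder A] [StarOrderedRing A] [PartialOrder B] [StarOrderedRing B] in
theorem LimRel.swap {a : selfAdjoint A} {b : selfAdjoint B} (h : LimRel M a b) :
    LimRel (fun k b a => M k a b) b a := by
  intro δ hδ
  obtain ⟨r, hr, hk⟩ := h δ hδ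
  exact ⟨r, hr, hk.mono fun k ⟨a', b', h₁, h₂, h₃⟩ => ⟨b', a', h₁, h₃, h₂⟩⟩

theorem tendsto_one_div_hyperfilter :
    Filter.Tendsto (fun k : ℕ => 1 / (k + 1 : ℝ)) (Filter.hyperfilter ℕ : Filter ℕ) (𝓝 0) :=
  tendsto_one_div_add_atTop_nhds_zero_nat.mono_left (by
    rw [← Nat.cofinite_eq_atTop]
    exact Filter.hyperfilter_le_cofinite)

namespace AsymptoticBridge

theorem swap (h : AsymptoticBridge LA LB M) :
    AsymptoticBridge LB LA (fun k b a => M k a b) where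
  add_le k b b' a a' := h.add_le k a a' b b'
  smul k r b a := h.smul k r a b
  map_one := h.map_one
  quotient_left := h.quotient_right
  quotient_right := h.quotient_left
  close_left k ψ := by
    obtain ⟨φ, hφ⟩ := h.close_right k ψ
    exact ⟨φ, fun b a hab => by rw [norm_sub_rev]; exact hφ a b hab⟩
  close_right k φ := by
    obtain ⟨ψ, hψ⟩ := h.close_left k φ
    exact ⟨ψ, fun b a hab => by rw [norm_sub_rev]; exact hψ a b hab⟩

variable (h : AsymptoticBridge LA LB M)

include h

theorem limRel_add {a a' : selfAdjoint A} {b b' : selfAdjoint B} (h₁ : LimRel M a b)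
    (h₂ : LimRel M a' b') : LimRel M (a + a') (b + b') := by
  intro δ hδ
  obtain ⟨r, hr, hk⟩ := h₁ (δ / 2) (half_pos hδ)
  obtain ⟨r', hr', hk'⟩ := h₂ (δ / 2) (half_pos hδ)
  refine ⟨r + r', add_pos hr hr', ?_⟩
  filter_upwards [hk, hk'] with k ⟨x, y, h1, h2, h3⟩ ⟨x', y', h1', h2', h3'⟩
  refine ⟨x + x', y + y', ?_, ?_, ?_⟩
  · rw [ENNReal.ofReal_add hr.le hr'.le]
    exact (h.add_le k x x' y y').trans (add_le_add h1 h1')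
  · rw [add_sub_add_comm]
    exact (norm_add_le _ _).trans (by linarith)
  · rw [add_sub_add_comm]
    exact (norm_add_le _ _).trans (by linarith)

theorem limRel_smul (s : ℝ) {a : selfAdjoint A} {b : selfAdjoint B} (h₁ : LimRel M a b) :
    LimRel M (s • a) (s • b) := by
  intro δ hδ
  -- The added `1` covers `s = 0`.
  have hs : 0 < |s| + 1 := by positivity
  obtain ⟨r, hr, hk⟩ := h₁ (δ / (|s| + 1)) (div_pos hδ hs)
  have hle : |s| * (δ / (|s| + 1)) ≤ δ := by
    rw [mul_div_assoc', div_le_iff₀ hs]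
    nlinarith [abs_nonneg s]
  refine ⟨(|s| + 1) * r, mul_pos hs hr, ?_⟩
  filter_upwards [hk] with k ⟨x, y, h1, h2, h3⟩
  refine ⟨s • x, s • y, ?_, ?_, ?_⟩
  · rw [h.smul, ENNReal.ofReal_mul hs.le, Real.enorm_eq_ofReal_abs]
    exact mul_le_mul' (ENNReal.ofReal_le_ofReal (by linarith)) h1
  · rw [← smul_sub, norm_smul, Real.norm_eq_abs]
    exact (mul_le_mul_of_nonneg_left h2 (abs_nonneg s)).trans hle
  · rw [← smul_sub, norm_smul, Real.norm_eq_abs]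
    exact (mul_le_mul_of_nonneg_left h3 (abs_nonneg s)).trans hle

theorem limRel_one : LimRel M 1 1 := fun δ hδ =>
  ⟨1, one_pos, Filter.Eventually.of_forall fun k => ⟨1, 1, by simp [h.map_one], by
    simpa using hδ.le, by simpa using hδ.le⟩⟩

theorem limRel_sub {a a' : selfAdjoint A} {b b' : selfAdjoint B} (h₁ : LimRel M a b)
    (h₂ : LimRel M a' b') : LimRel M (a - a') (b - b') := by
  have := h.limRel_add h₁ (h.limRel_smul (-1) h₂)
  simpa [sub_eq_add_neg] using this

/-- Matricial states of `A` and `B` that are close on the unit ball of `M k` are close on every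
ball. -/
theorem exists_close (k : ℕ) (φ : UCP 2 A) : ∃ ψ : UCP 2 B,
    ∀ (a : selfAdjoint A) (b : selfAdjoint B) (r : ℝ), 0 < r → M k a b ≤ ENNReal.ofReal r →
      ∀ i j, ‖φ.1 (a : A) i j - ψ.1 (b : B) i j‖ ≤ r * (1 / (k + 1 : ℝ)) := by
  obtain ⟨ψ, hψ⟩ := h.close_left k φ
  refine ⟨ψ, fun a b r hr hab i j => ?_⟩
  have := hψ (r⁻¹ • a) (r⁻¹ • b) (by rw [h.smul]; exact enorm_inv_mul_le_one hr hab)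
  rw [selfAdjoint.val_smul, selfAdjoint.val_smul, ← Complex.coe_smul, ← Complex.coe_smul, map_smul,
    map_smul, ← smul_sub, norm_smul, Complex.norm_real, Real.norm_eq_abs,
    abs_of_pos (inv_pos.mpr hr), inv_mul_le_iff₀ hr] at this
  rw [← CStarMatrix.sub_apply]
  exact CStarMatrix.norm_entry_le_norm.trans this

/-- Every matricial state of `A` is a limit of matricial states of `B` along related elements. -/
theorem exists_ucp_tendsto (φ : UCP 2 A) : ∃ ψ : ℕ → UCP 2 B,
    ∀ (a : selfAdjoint A) (b : selfAdjoint B), LimRel M a b → ∀ i j,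
      Filter.Tendsto (fun k => (ψ k).1 (b : B) i j) (Filter.hyperfilter ℕ : Filter ℕ)
        (𝓝 (φ.1 (a : A) i j)) := by
  choose ψ hψ using fun k => h.exists_close k φ
  refine ⟨ψ, fun a b hab i j => Metric.tendsto_nhds.mpr fun ε hε => ?_⟩
  obtain ⟨r, hr, hk⟩ := hab (ε / 4) (by positivity)
  -- The bound `r` does not depend on `k`, so the mismatch `r/(k+1)` between the matricial states
  -- tends to zero.
  have hlim := (tendsto_one_div_hyperfilter.const_mul r).eventually
    (gt_mem_nhds (show r * 0 < ε / 4 by simpa using by positivity))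
  filter_upwards [hk, hlim] with k ⟨x, y, h1, h2, h3⟩ h4
  have e : (ψ k).1 (b : B) i j - φ.1 (a : A) i j = φ.1 ((x - a : selfAdjoint A) : A) i j -
      (φ.1 (x : A) i j - (ψ k).1 (y : B) i j) - (ψ k).1 ((y - b : selfAdjoint B) : B) i j := by
    rw [AddSubgroupClass.coe_sub, AddSubgroupClass.coe_sub, map_sub, map_sub,
      CStarMatrix.sub_apply, CStarMatrix.sub_apply]
    ring
  rw [dist_eq_norm, e]
  have h5 := (φ.norm_apply_le_of_isSelfAdjoint (x - a).2 i j).trans h2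
  have h6 := ((ψ k).norm_apply_le_of_isSelfAdjoint (y - b).2 i j).trans h3
  have h7 := hψ k x y r hr h1 i j
  refine (norm_sub_le _ _).trans_lt ?_
  have h8 := norm_sub_le (φ.1 ((x - a : selfAdjoint A) : A) i j)
    (φ.1 (x : A) i j - (ψ k).1 (y : B) i j)
  linarith

/-- A state of `B` is a diagonal entry of a matricial state, so its value at `b` is a limit of
diagonal entries of matricial states of `A` at `a`, all nonnegative. -/
theorem limRel_nonneg {a : selfAdjoint A} {b : selfAdjoint B} (hab : LimRel M a b)
    (ha : 0 ≤ (a : A)) : 0 ≤ (b : B) := by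
  refine nonneg_of_forall_state b.2 fun ν hν => ?_
  obtain ⟨ψ, hψ⟩ := exists_ucp_eq_diagonal 2 ν hν
  obtain ⟨φ, hφ⟩ := h.swap.exists_ucp_tendsto ψ
  have := hφ b a hab.swap 0 0
  rw [hψ, if_pos rfl] at this
  refine ge_of_tendsto' ((Complex.continuous_re.tendsto _).comp this) fun k => ?_
  exact (Complex.nonneg_iff.mp (cstarMatrix_diag_nonneg (map_nonneg (φ k).1 ha) 0)).1

/-- The units are related, so positivity of `‖a‖ ± a` passes to `‖a‖ ± b`. -/
theorem limRel_norm_le {a : selfAdjoint A} {b : selfAdjoint B} (hab : LimRel M a b) :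
    ‖b‖ ≤ ‖a‖ := by
  have hc := h.limRel_smul ‖a‖ h.limRel_one
  have e₁ : ((‖a‖ • (1 : selfAdjoint A) : selfAdjoint A) : A) = algebraMap ℝ A ‖(a : A)‖ := by
    rw [Algebra.algebraMap_eq_smul_one]; rfl
  have e₂ : ((‖a‖ • (1 : selfAdjoint B) : selfAdjoint B) : B) = algebraMap ℝ B ‖a‖ := by
    rw [Algebra.algebraMap_eq_smul_one]; rfl
  refine norm_le_of_neg_algebraMap_le_of_le b.2 (norm_nonneg a) ?_ ?_
  · have := h.limRel_nonneg (h.limRel_add hab hc) (by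
      rw [AddSubgroup.coe_add, e₁, ← neg_le_iff_add_nonneg]
      exact IsSelfAdjoint.neg_algebraMap_norm_le_self a.2)
    rwa [AddSubgroup.coe_add, e₂, ← neg_le_iff_add_nonneg] at this
  · have := h.limRel_nonneg (h.limRel_sub hc hab) (by
      rw [AddSubgroupClass.coe_sub, e₁, sub_nonneg]
      exact IsSelfAdjoint.le_algebraMap_norm_self a.2)
    rwa [AddSubgroupClass.coe_sub, e₂, sub_nonneg] at this

theorem limRel_right_unique {a : selfAdjoint A} {b b' : selfAdjoint B} (hb : LimRel M a b)
    (hb' : LimRel M a b') : b = b' := by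
  have := h.limRel_norm_le (h.limRel_sub hb hb')
  rw [sub_self, norm_zero] at this
  exact sub_eq_zero.mp (norm_le_zero_iff.mp this)

/-- A bound for the norm of the partner of `a` under the seminorm `M k`. -/
theorem norm_le_of_seminorm_le (k : ℕ) {a : selfAdjoint A} {b : selfAdjoint B} {r : ℝ} (hr : 0 < r)
    (hab : M k a b ≤ ENNReal.ofReal r) : ‖b‖ ≤ ‖a‖ + r := by
  refine norm_le_of_forall_state b.2 (by positivity) fun ν hν => ?_
  obtain ⟨ψ, hψ⟩ := exists_ucp_eq_diagonal 2 ν hν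
  obtain ⟨φ, hφ⟩ := h.swap.exists_close k ψ
  have h1 := hφ b a r hr hab 0 0
  rw [hψ, if_pos rfl] at h1
  have h2 := φ.norm_apply_le_of_isSelfAdjoint a.2 0 0
  have h3 : r * (1 / (k + 1 : ℝ)) ≤ r := by
    refine mul_le_of_le_one_right hr.le ?_
    rw [div_le_one (by positivity)]
    have : (0 : ℝ) ≤ k := k.cast_nonneg
    linarith
  have h4 := norm_sub_norm_le (ν (b : B)) (φ.1 (a : A) 0 0)
  change ‖φ.1 (a : A) 0 0‖ ≤ ‖a‖ at h2
  linarith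

/-- The quotient condition supplies partners `b k` with `M k a (b k)` within `1/(k+1)` of `LA a`.
They are bounded in norm and in `LB`, so they converge along the ultrafilter. The limit need not
have `LB` at most `LA a`, since `LB` may fail to be lower semicontinuous; hence the closure. -/
theorem exists_limRel_of_lt_top (hLB : IsLipNorm LB) {a : selfAdjoint A} (ha : LA a < ∞) :
    ∃ b, LimRel M a b ∧ ∀ r, LA a < r → b ∈ closure {y | LB y ≤ r} := by
  have hk : ∀ k : ℕ, ∃ b, M k a b < LA a + ENNReal.ofReal (1 / (k + 1 : ℝ)) := by
    intro k
    have : ⨅ b, M k a b < LA a + ENNReal.ofReal (1 / (k + 1 : ℝ)) := by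
      rw [← h.quotient_left k a]
      refine ENNReal.lt_add_right ha.ne ?_
      rw [Ne, ENNReal.ofReal_eq_zero, not_le]
      positivity
    exact iInf_lt_iff.mp this
  choose b hb using hk
  set r₀ : ℝ := (LA a).toReal + 1 with hr₀
  have hr₀pos : 0 < r₀ := by positivity
  have hbound : ∀ k, M k a (b k) ≤ ENNReal.ofReal r₀ := by
    intro k
    refine (hb k).le.trans ?_
    rw [hr₀, ENNReal.ofReal_add ENNReal.toReal_nonneg zero_le_one, ENNReal.ofReal_toReal ha.ne]
    gcongr
    rw [div_le_one (by positivity)]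
    have : (0 : ℝ) ≤ k := k.cast_nonneg
    linarith
  have hLBb : ∀ k, LB (b k) ≤ M k a (b k) := fun k => by
    rw [h.quotient_right k]
    exact iInf_le _ a
  obtain ⟨b₀, hb₀⟩ := hLB.exists_tendsto (Filter.hyperfilter ℕ) hr₀pos
    (fun k => (hLBb k).trans (hbound k)) (fun k => h.norm_le_of_seminorm_le k hr₀pos (hbound k))
  refine ⟨b₀, fun δ hδ => ⟨r₀, hr₀pos, ?_⟩, fun r hr => ?_⟩
  · filter_upwards [hb₀.eventually (Metric.closedBall_mem_nhds b₀ hδ)] with k hk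
    exact ⟨a, b k, hbound k, by simpa using hδ.le, by rwa [← dist_eq_norm]⟩
  · refine mem_closure_of_tendsto hb₀ ?_
    have hlim : Filter.Tendsto (fun k : ℕ => LA a + ENNReal.ofReal (1 / (k + 1 : ℝ)))
        (Filter.hyperfilter ℕ : Filter ℕ) (𝓝 (LA a + ENNReal.ofReal 0)) :=
      tendsto_const_nhds.add (ENNReal.tendsto_ofReal tendsto_one_div_hyperfilter)
    rw [ENNReal.ofReal_zero, add_zero] at hlim
    filter_upwards [hlim.eventually (gt_mem_nhds hr)] with k hk
    exact (hLBb k).trans ((hb k).le.trans hk.le)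

/-- Extension by density: partners of a sequence from the domain are Cauchy because the relation is
contractive, and the relation is closed under norm limits. -/
theorem exists_limRel (hLA : IsLipNorm LA) (hLB : IsLipNorm LB) (a : selfAdjoint A) :
    ∃ b, LimRel M a b := by
  obtain ⟨x, hx, hxa⟩ := mem_closure_iff_seq_limit.mp (hLA.dense a)
  choose y hy _ using fun n => h.exists_limRel_of_lt_top hLB (hx n)
  have hcauchy : CauchySeq y := by
    refine Metric.cauchySeq_iff'.mpr fun ε hε => ?_
    obtain ⟨N, hN⟩ := Metric.cauchySeq_iff'.mp hxa.cauchySeq ε hε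
    refine ⟨N, fun n hn => lt_of_le_of_lt ?_ (hN n hn)⟩
    rw [dist_eq_norm, dist_eq_norm]
    exact h.limRel_norm_le (h.limRel_sub (hy n) (hy N))
  obtain ⟨b, hb⟩ := cauchySeq_tendsto_of_complete hcauchy
  refine ⟨b, fun δ hδ => ?_⟩
  obtain ⟨n, hn₁, hn₂⟩ := ((hxa.eventually (Metric.ball_mem_nhds a (half_pos hδ))).and
    (hb.eventually (Metric.ball_mem_nhds b (half_pos hδ)))).exists
  rw [dist_eq_norm] at hn₁ hn₂
  obtain ⟨r, hr, hk⟩ := hy n (δ / 2) (half_pos hδ)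
  refine ⟨r, hr, hk.mono fun k ⟨a', b', h1, h2, h3⟩ => ⟨a', b', h1, ?_, ?_⟩⟩
  · linarith [norm_sub_le_norm_sub_add_norm_sub a' (x n) a]
  · linarith [norm_sub_le_norm_sub_add_norm_sub b' (y n) b]

theorem lipClosure_le (hLB : IsLipNorm LB) {a : selfAdjoint A}
    {b : selfAdjoint B} (hab : LimRel M a b) : lipClosure LB b ≤ lipClosure LA a := by
  refine le_sInf fun r hr => le_of_forall_gt_imp_ge_of_dense fun s hs => sInf_le ?_
  have hrtop : r < ∞ := hs.trans_le le_top
  refine Metric.mem_closure_iff.mpr fun ε hε => ?_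
  obtain ⟨x, hx, hxa⟩ := Metric.mem_closure_iff.mp hr (ε / 2) (half_pos hε)
  -- `a` is approximated by `x` in the `r`-ball; the partner `y` of `x` is at least as close to `b`,
  -- and lies in the closure of every `s`-ball with `s > r`.
  obtain ⟨y, hxy, hy⟩ := h.exists_limRel_of_lt_top hLB (a := x) (lt_of_le_of_lt hx hrtop)
  obtain ⟨z, hz, hyz⟩ := Metric.mem_closure_iff.mp (hy s (lt_of_le_of_lt hx hs)) (ε / 2)
    (half_pos hε)
  refine ⟨z, hz, ?_⟩
  have hby : dist b y ≤ dist a x := by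
    rw [dist_eq_norm, dist_eq_norm]
    exact h.limRel_norm_le (h.limRel_sub hab hxy)
  linarith [dist_triangle b y z]

end AsymptoticBridge

end

/-! ### Complexification and multiplicativity of the limit relation. -/

variable {A B : Type*} [CStarAlgebra A] [PartialOrder A] [StarOrderedRing A]
  [CStarAlgebra B] [PartialOrder B] [StarOrderedRing B]

/-- The complexification of `LimRel`. -/
def ComplexLimRel (M : ℕ → selfAdjoint A → selfAdjoint B → ℝ≥0∞) (x : A) (y : B) : Prop :=
  LimRel M (realPart x) (realPart y) ∧ LimRel M (imaginaryPart x) (imaginaryPart y)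

variable {LA : selfAdjoint A → ℝ≥0∞} {LB : selfAdjoint B → ℝ≥0∞}
  {M : ℕ → selfAdjoint A → selfAdjoint B → ℝ≥0∞}

omit [PartialOrder A] [StarOrderedRing A] [PartialOrder B] [StarOrderedRing B] in
theorem ComplexLimRel.swap {x : A} {y : B} (h : ComplexLimRel M x y) :
    ComplexLimRel (fun k b a => M k a b) y x := ⟨h.1.swap, h.2.swap⟩

omit [PartialOrder A] [StarOrderedRing A] in
theorem realPart_star_eq (x : A) : realPart (star x) = realPart x :=
  Subtype.ext (by rw [realPart_apply_coe, realPart_apply_coe, star_star, add_comm])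

omit [PartialOrder A] [StarOrderedRing A] in
theorem imaginaryPart_star_eq (x : A) : imaginaryPart (star x) = -imaginaryPart x :=
  Subtype.ext (by
    rw [NegMemClass.coe_neg, imaginaryPart_apply_coe, imaginaryPart_apply_coe, star_star,
      ← smul_neg, ← smul_neg, neg_sub])

omit [PartialOrder A] [StarOrderedRing A] in
theorem star_mul_eq_polarization (u v : A) : star u * v = (2⁻¹ : ℂ) •
    ((star (u + v) * (u + v) - star u * u - star v * v) -
      Complex.I • (star (u + Complex.I • v) * (u + Complex.I • v) - star u * u -
        star (Complex.I • v) * (Complex.I • v))) := by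
  have e₁ : star (u + v) * (u + v) - star u * u - star v * v = star u * v + star v * u := by
    rw [star_add]
    noncomm_ring
  have e₂ : star (u + Complex.I • v) * (u + Complex.I • v) - star u * u -
      star (Complex.I • v) * (Complex.I • v) =
        Complex.I • (star u * v) - Complex.I • (star v * u) := by
    have hstar : star (Complex.I • v) = -(Complex.I • star v) := by
      rw [star_smul, Complex.star_def, Complex.conj_I, neg_smul]
    have hmul : (Complex.I • star v) * u = Complex.I • (star v * u) := smul_mul_assoc _ _ _
    rw [star_add, add_mul, mul_add, mul_add, hstar, neg_mul _ u, hmul, mul_smul_comm]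
    abel
  rw [e₁, e₂, smul_sub Complex.I, smul_smul, smul_smul, Complex.I_mul_I, neg_smul, one_smul,
    neg_smul, one_smul, sub_neg_eq_add]
  rw [show star u * v + star v * u - (-(star u * v) + star v * u) = (2 : ℂ) • (star u * v) by
    rw [two_smul]; abel, smul_smul]
  norm_num

namespace AsymptoticBridge

variable (h : AsymptoticBridge LA LB M)

include h

theorem complexLimRel_coe {a : selfAdjoint A} {b : selfAdjoint B} (hab : LimRel M a b) :
    ComplexLimRel M (a : A) (b : B) := by
  refine ⟨by simpa using hab, ?_⟩
  have := h.limRel_smul 0 hab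
  simpa using this

theorem complexLimRel_add {x x' : A} {y y' : B} (h₁ : ComplexLimRel M x y)
    (h₂ : ComplexLimRel M x' y') : ComplexLimRel M (x + x') (y + y') := by
  refine ⟨?_, ?_⟩
  · rw [map_add, map_add]; exact h.limRel_add h₁.1 h₂.1
  · rw [map_add, map_add]; exact h.limRel_add h₁.2 h₂.2

theorem complexLimRel_smul (c : ℂ) {x : A} {y : B} (h₁ : ComplexLimRel M x y) :
    ComplexLimRel M (c • x) (c • y) := by
  refine ⟨?_, ?_⟩
  · rw [realPart_smul, realPart_smul]
    exact h.limRel_sub (h.limRel_smul _ h₁.1) (h.limRel_smul _ h₁.2)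
  · rw [imaginaryPart_smul, imaginaryPart_smul]
    exact h.limRel_add (h.limRel_smul _ h₁.2) (h.limRel_smul _ h₁.1)

theorem complexLimRel_sub {x x' : A} {y y' : B} (h₁ : ComplexLimRel M x y)
    (h₂ : ComplexLimRel M x' y') : ComplexLimRel M (x - x') (y - y') := by
  have := h.complexLimRel_add h₁ (h.complexLimRel_smul (-1) h₂)
  simpa [sub_eq_add_neg] using this

theorem complexLimRel_star {x : A} {y : B} (h₁ : ComplexLimRel M x y) :
    ComplexLimRel M (star x) (star y) := by
  refine ⟨?_, ?_⟩
  · rw [realPart_star_eq, realPart_star_eq]; exact h₁.1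
  · rw [imaginaryPart_star_eq, imaginaryPart_star_eq, ← neg_one_smul ℝ (imaginaryPart x),
      ← neg_one_smul ℝ (imaginaryPart y)]
    exact h.limRel_smul (-1) h₁.2

theorem complexLimRel_right_unique {x : A} {y y' : B} (h₁ : ComplexLimRel M x y)
    (h₂ : ComplexLimRel M x y') : y = y' :=
  ComplexStarModule.ext (h.limRel_right_unique h₁.1 h₂.1) (h.limRel_right_unique h₁.2 h₂.2)

theorem exists_complexLimRel (hLA : IsLipNorm LA) (hLB : IsLipNorm LB) (x : A) :
    ∃ y, ComplexLimRel M x y := by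
  obtain ⟨a, ha⟩ := h.exists_limRel hLA hLB (realPart x)
  obtain ⟨b, hb⟩ := h.exists_limRel hLA hLB (imaginaryPart x)
  refine ⟨a + Complex.I • b, ?_⟩
  have := h.complexLimRel_add (h.complexLimRel_coe ha)
    (h.complexLimRel_smul Complex.I (h.complexLimRel_coe hb))
  rwa [realPart_add_I_smul_imaginaryPart] at this

theorem exists_ucp_tendsto_complex (φ : UCP 2 A) : ∃ ψ : ℕ → UCP 2 B,
    ∀ (x : A) (y : B), ComplexLimRel M x y → ∀ i j,
      Filter.Tendsto (fun k => (ψ k).1 y i j) (Filter.hyperfilter ℕ : Filter ℕ)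
        (𝓝 (φ.1 x i j)) := by
  obtain ⟨ψ, hψ⟩ := h.exists_ucp_tendsto φ
  refine ⟨ψ, fun x y hxy i j => ?_⟩
  have h₁ := hψ _ _ hxy.1 i j
  have h₂ := (hψ _ _ hxy.2 i j).const_mul Complex.I
  have := h₁.add h₂
  simpa only [UCP.realPart_add_I_mul_imaginaryPart] using this

theorem complexLimRel_nonneg {x : A} {y : B} (hxy : ComplexLimRel M x y) (hx : 0 ≤ x) :
    0 ≤ y := by
  have hsa : star y = y := by
    refine h.complexLimRel_right_unique (h.complexLimRel_star hxy) ?_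
    rwa [(IsSelfAdjoint.of_nonneg hx).star_eq]
  have := h.limRel_nonneg hxy.1 (by rwa [(IsSelfAdjoint.of_nonneg hx).coe_realPart])
  rwa [IsSelfAdjoint.coe_realPart hsa] at this

/-- The Kadison–Schwarz inequality for the inverse of the map defined by the relation. -/
theorem star_mul_self_le_of_complexLimRel {x w : A} {y : B} (hxy : ComplexLimRel M x y)
    (hw : ComplexLimRel M w (star y * y)) : star x * x ≤ w := by
  have hwsa : star w = w := by
    refine h.swap.complexLimRel_right_unique (h.complexLimRel_star hw).swap ?_
    rw [star_mul, star_star]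
    exact hw.swap
  rw [← sub_nonneg]
  refine nonneg_of_forall_state (IsSelfAdjoint.sub hwsa (.star_mul_self x)) fun μ hμ => ?_
  obtain ⟨φ, hφ₁, hφ₂⟩ := exists_ucp_two_column μ hμ x
  obtain ⟨ψ, hψ⟩ := h.exists_ucp_tendsto_complex φ
  have hlim : ∀ i, Filter.Tendsto (fun k => ‖(ψ k).1 y i 0‖ ^ 2)
      (Filter.hyperfilter ℕ : Filter ℕ) (𝓝 (‖φ.1 x i 0‖ ^ 2)) := fun i =>
    (hψ x y hxy i 0).norm.pow 2
  -- Kadison–Schwarz holds for each `ψ k` on `B`. In the limit the column sum is exactly `μ(x⋆x)` by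
  -- the choice of `φ`, and the right side is `μ(w)`.
  have hle := le_of_tendsto_of_tendsto' ((hlim 0).add (hlim 1))
    ((Complex.continuous_re.tendsto _).comp (hψ w _ hw 0 0)) fun k => by
      have := (ψ k).sum_norm_sq_le y 0
      rwa [Fin.sum_univ_two] at this
  rw [hφ₂, hφ₁] at hle
  rw [map_sub, Complex.sub_re]
  linarith

/-- Let `z` and `w` be the partners of `x⋆x` and `y⋆y`. Kadison–Schwarz in both directions gives
`y⋆y ≤ z` and `x⋆x ≤ w`; transporting the latter to `B` gives `z ≤ y⋆y`. -/
theorem complexLimRel_star_mul_self (hLA : IsLipNorm LA) (hLB : IsLipNorm LB) {x : A} {y : B}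
    (hxy : ComplexLimRel M x y) : ComplexLimRel M (star x * x) (star y * y) := by
  obtain ⟨z, hz⟩ := h.exists_complexLimRel hLA hLB (star x * x)
  obtain ⟨w, hw⟩ := h.swap.exists_complexLimRel hLB hLA (star y * y)
  have h₁ : star y * y ≤ z := h.swap.star_mul_self_le_of_complexLimRel hxy.swap hz.swap
  have h₂ : star x * x ≤ w := h.star_mul_self_le_of_complexLimRel hxy hw.swap
  have h₃ : 0 ≤ star y * y - z :=
    h.complexLimRel_nonneg (h.complexLimRel_sub hw.swap hz) (sub_nonneg.mpr h₂)
  rwa [le_antisymm h₁ (sub_nonneg.mp h₃)]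

theorem complexLimRel_mul (hLA : IsLipNorm LA) (hLB : IsLipNorm LB) {x x' : A} {y y' : B}
    (hxy : ComplexLimRel M x y) (hxy' : ComplexLimRel M x' y') :
    ComplexLimRel M (x * x') (y * y') := by
  have p : ∀ {u u' : A} {v v' : B}, ComplexLimRel M u v → ComplexLimRel M u' v' →
      ComplexLimRel M (star (u + u') * (u + u') - star u * u - star u' * u')
        (star (v + v') * (v + v') - star v * v - star v' * v') := fun h₁ h₂ =>
    h.complexLimRel_sub (h.complexLimRel_sub
      (h.complexLimRel_star_mul_self hLA hLB (h.complexLimRel_add h₁ h₂))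
      (h.complexLimRel_star_mul_self hLA hLB h₁)) (h.complexLimRel_star_mul_self hLA hLB h₂)
  -- Polarization expresses products `u⋆v`, so it is applied with `u = x⋆`.
  have hs := h.complexLimRel_star hxy
  have := h.complexLimRel_smul 2⁻¹ (h.complexLimRel_sub (p hs hxy')
    (h.complexLimRel_smul Complex.I (p hs (h.complexLimRel_smul Complex.I hxy'))))
  rwa [← star_mul_eq_polarization, ← star_mul_eq_polarization, star_star, star_star] at this

/-- The limit relation is the graph of a ⋆-isomorphism. -/
theorem exists_starAlgEquiv (hLA : IsLipNorm LA) (hLB : IsLipNorm LB) :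
    ∃ Φ : A ≃⋆ₐ[ℂ] B, ∀ a : selfAdjoint A, LimRel M a (mapSelfAdjoint Φ a) := by
  choose f hf using h.exists_complexLimRel hLA hLB
  choose g hg using h.swap.exists_complexLimRel hLB hLA
  let Φ : A ≃⋆ₐ[ℂ] B :=
    { toFun := f
      invFun := g
      left_inv := fun x => h.swap.complexLimRel_right_unique (hg (f x)) (hf x).swap
      right_inv := fun y => h.complexLimRel_right_unique (hf (g y)) (hg y).swap
      map_mul' := fun x x' => h.complexLimRel_right_unique (hf _)
        (h.complexLimRel_mul hLA hLB (hf x) (hf x'))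
      map_add' := fun x x' => h.complexLimRel_right_unique (hf _)
        (h.complexLimRel_add (hf x) (hf x'))
      map_star' := fun x => h.complexLimRel_right_unique (hf _) (h.complexLimRel_star (hf x))
      map_smul' := fun c x => h.complexLimRel_right_unique (hf _)
        (h.complexLimRel_smul c (hf x)) }
  refine ⟨Φ, fun a => ?_⟩
  have h₁ : LimRel M (realPart (a : A)) (realPart (Φ a)) := (hf a).1
  have h₂ : realPart (Φ a) = mapSelfAdjoint Φ a :=
    selfAdjoint.realPart_coe (x := mapSelfAdjoint Φ a)
  rwa [selfAdjoint.realPart_coe, h₂] at h₁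

end AsymptoticBridge

/-! ### From distance zero to the bridge, and the lower semicontinuous case. -/

omit [PartialOrder A] [StarOrderedRing A] [PartialOrder B] [StarOrderedRing B] in
theorem pair_add (a a' : selfAdjoint A) (b b' : selfAdjoint B) :
    pair (a + a') (b + b') = pair a b + pair a' b' := rfl

omit [PartialOrder A] [StarOrderedRing A] [PartialOrder B] [StarOrderedRing B] in
theorem pair_smul (r : ℝ) (a : selfAdjoint A) (b : selfAdjoint B) :
    pair (r • a) (r • b) = r • pair a b := rfl

/-- Vanishing of the second matricial distance produces an asymptotic bridge. -/
theorem exists_asymptoticBridge (hdist : matricialDist 2 LA LB = 0) :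
    ∃ M, AsymptoticBridge LA LB M := by
  have key : ∀ k : ℕ, ∃ L : selfAdjoint (A × B) → ℝ≥0∞, IsAdmissible LA LB L ∧
      hausdorffDistOf (ucpDist L)
        (Set.range fun φ : UCP 2 A => φ.comp (StarAlgHom.fst ℂ A B))
        (Set.range fun ψ : UCP 2 B => ψ.comp (StarAlgHom.snd ℂ A B)) <
          ENNReal.ofReal (1 / (k + 1 : ℝ)) := by
    intro k
    have : matricialDist 2 LA LB < ENNReal.ofReal (1 / (k + 1 : ℝ)) := by
      rw [hdist, ENNReal.ofReal_pos]
      positivity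
    simpa only [matricialDist, iInf_lt_iff, exists_prop] using this
  choose L hL hLdist using key
  have hnorm : ∀ {k : ℕ} {r : ℝ≥0∞}, r < ENNReal.ofReal (1 / (k + 1 : ℝ)) →
      ∀ {φ ψ : UCP 2 (A × B)}, ucpDist (L k) φ ψ < r → ∀ x, L k x ≤ 1 →
        ‖φ.1 (x : A × B) - ψ.1 (x : A × B)‖ ≤ 1 / (k + 1 : ℝ) := by
    intro k r hr φ ψ hlt x hx
    have h₁ : ‖φ.1 (x : A × B) - ψ.1 (x : A × B)‖ₑ ≤ ENNReal.ofReal (1 / (k + 1 : ℝ)) :=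
      ((le_iSup₂ (f := fun (a : selfAdjoint (A × B)) (_ : L k a ≤ 1) =>
        ‖φ.1 (a : A × B) - ψ.1 (a : A × B)‖ₑ) x hx).trans hlt.le).trans hr.le
    rw [← ofReal_norm] at h₁
    exact (ENNReal.ofReal_le_ofReal_iff (by positivity)).mp h₁
  refine ⟨fun k a b => L k (pair a b), ?_, ?_, ?_, fun k => (hL k).quotient_left,
    fun k => (hL k).quotient_right, ?_, ?_⟩
  · intro k a a' b b'
    rw [pair_add]
    exact (hL k).isLipNorm.add_le _ _
  · intro k r a b
    rw [pair_smul]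
    exact (hL k).isLipNorm.smul _ _
  · exact fun k => (hL k).isLipNorm.map_one
  · intro k φ
    obtain ⟨r, ⟨-, hr⟩, hlt⟩ := sInf_lt_iff.mp (hLdist k)
    obtain ⟨_, ⟨ψ, rfl⟩, hψ⟩ := hr _ ⟨φ, rfl⟩
    exact ⟨ψ, fun a b hab => hnorm hlt hψ (pair a b) hab⟩
  · intro k ψ
    obtain ⟨r, ⟨hr, -⟩, hlt⟩ := sInf_lt_iff.mp (hLdist k)
    obtain ⟨_, ⟨φ, rfl⟩, hφ⟩ := hr _ ⟨ψ, rfl⟩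
    refine ⟨φ, fun a b hab => ?_⟩
    rw [norm_sub_rev]
    exact hnorm hlt hφ (pair a b) hab

omit [PartialOrder A] [StarOrderedRing A] in
theorem lipClosure_eq_of_lowerSemicontinuous {L : selfAdjoint A → ℝ≥0∞}
    (hL : LowerSemicontinuous L) : lipClosure L = L := by
  ext1 a
  have : {r : ℝ≥0∞ | a ∈ closure {x | L x ≤ r}} = Set.Ici (L a) := by
    ext r
    have hr : IsClosed {x | L x ≤ r} := hL.isClosed_preimage r
    change a ∈ closure {x | L x ≤ r} ↔ _
    rw [hr.closure_eq]
    rfl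
  rw [lipClosure, this, csInf_Ici]

end QuantumMetric

end

theorem theorem7p2 {A B : Type*}
    [CStarAlgebra A] [PartialOrder A] [StarOrderedRing A]
    [CStarAlgebra B] [PartialOrder B] [StarOrderedRing B]
    (LA : selfAdjoint A → ℝ≥0∞) (LB : selfAdjoint B → ℝ≥0∞)
    (hLA : QuantumMetric.IsLipNorm LA) (hLB : QuantumMetric.IsLipNorm LB)
    (hdist : QuantumMetric.matricialDist 2 LA LB = 0) :
    ∃ Φ : A ≃⋆ₐ[ℂ] B,
      Isometry Φ ∧
      (∀ a : selfAdjoint A,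
        QuantumMetric.lipClosure LB (QuantumMetric.mapSelfAdjoint Φ a) =
          QuantumMetric.lipClosure LA a) ∧
      (LowerSemicontinuous LA → LowerSemicontinuous LB →
        ∀ a : selfAdjoint A, LB (QuantumMetric.mapSelfAdjoint Φ a) = LA a) := by
  obtain ⟨M, h⟩ := QuantumMetric.exists_asymptoticBridge hdist
  obtain ⟨Φ, hΦ⟩ := h.exists_starAlgEquiv hLA hLB
  have key : ∀ a : selfAdjoint A, QuantumMetric.lipClosure LB
      (QuantumMetric.mapSelfAdjoint Φ a) = QuantumMetric.lipClosure LA a := fun a =>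
    le_antisymm (h.lipClosure_le hLB (hΦ a)) (h.swap.lipClosure_le hLA (hΦ a).swap)
  refine ⟨Φ, StarAlgEquiv.isometry Φ, key, fun hA hB a => ?_⟩
  have := key a
  rwa [QuantumMetric.lipClosure_eq_of_lowerSemicontinuous hA,
    QuantumMetric.lipClosure_eq_of_lowerSemicontinuous hB] at this
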